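/- **Model.** Consider $n\ge 2$ asynchronous processes that communicate through atomic multi-reader multi-writer registers (with values in a countable domain) and flip private coins; every coin flip yields an independent value from a countable space $\Omega$ with a fixed distribution $\mathcal D$. An execution is a sequence of steps (coin flips, reads, writes; a finished process that is scheduled performs a no-op). An adversary $A$ is a function mapping each finite execution $\mathcal E$ to the process that takes the next step; together with an algorithm $M$ and random coin flips it yields a random infinite execution $\mathcal E_{M,A}$. $A$ is *location-oblivious* for $M$ if $A(\mathcal E)$ depends only on (i) the past schedule (sequence of process IDs), (ii) for each process $p$, the values of the coin flips of $p$ preceding $p$'s latest shared memory step in $\mathcal E$, and (iii) for each unfinished process whose next step is a shared memory step, whether that step is a read or a write and, for a write, the value to be written. **Algorithm.** Let $\ell=\lceil\log_2 n\rceil$, and let $R[1],\dots,R[\ell+1]$ be registers, initially $0$, accessed only by the following method. $\mathrm{elect}()$: choose by a coin flip $x\in\{1,\dots,\ell\}$ with $\Pr(x=i)=2^{-i}$ for $1\le i<\ell$ and $\Pr(x=\ell)=2^{-(\ell-1)}$; write $1$ to $R[x]$; read $R[x+1]$; return *win* if the value read is $0$, and *lose* otherwise. (A coin flip whose value is ignored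 stands between the write and the read, so that coin flips and shared memory steps alternate.) **Measures.** Let $M$ be any algorithm for the $n$ processes in which each process calls $\mathrm{elect}()$ at most once, possibly besides arbitrary other steps. A process *participates* if it invokes $\mathrm{elect}()$, and is *elected* if its call returns win. The max-step complexity of $\mathrm{elect}()$ in an execution is the maximum over all processes $p$ of the number of shared memory steps that $p$ executes during its $\mathrm{elect}()$ call. The max-contention of a finite execution $\mathcal E'$ is the maximum number of processes that invoke $\mathrm{elect}()$ in any execution of $M$ that extends $\mathcal E'$. For $1\le k\le n$ let $\mathrm{Exec}_{M,A}(k)$ be the set of the finite executions $\mathcal E'$ of $M$ that result with positive probability for $A$, end when the first process becomes poised to invoke $\mathrm{elect}()$, and have max-contention at most $k$. The *effectiveness* in $M$ against $A$ is $$\varphi_{M,A}(k)=\sup_{\mathcal E'\in \mathrm{Exec}_{M,A}(k)}\mathbb E\bigl[\text{number of elected processes in }\mathcal E_{M,A}\,\bigm|\,\mathcal E_{M,A}\text{ extends }\mathcal E'\bigr],$$ and the *expected max-step complexity* $\tau_{M,A}(k)$ is defined in the same way from the max-step complexity of $\mathrm{elect}()$ in $\mathcal E_{M,A}$. **Lemma.**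 For every such $M$: 1. (Group election.) In every execution in which at least one process participates and all participating processes finish their $\mathrm{elect}()$ calls, at least one process is elected. Moreover, each call returns after at most three further steps of the calling process following its first step. 2. (Constant max-step complexity.) In every execution each process executes at most $2$ shared memory steps during its $\mathrm{elect}()$ call. In particular, against every location-oblivious adversary $A$ and for $1\le k\le n$, the max-step complexity is at most $2$ with conditional probability $1$ given that $\mathcal E_{M,A}$ extends $\mathcal E'$, for every $\mathcal E'\in\mathrm{Exec}_{M,A}(k)$, and $\tau_{M,A}(k)\le 2$. 3. (Effectiveness.) For every location-oblivious adversary $A$ for $M$ and every $1\le k\le n$, $\ \varphi_{M,A}(k)\le 2\log_2 k+4$. -/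

import Mathlib

open MeasureTheory ProbabilityTheory
open scoped ENNReal

namespace GroupElection

/-! ### Asynchronous shared memory: `n` processes, atomic registers, private coin flips

Every coin flip yields a value in the countable space `Ω` with the fixed distribution `D`.
Registers hold natural numbers, i.e. values of a countable domain. -/

/-- `ℓ = ⌈log₂ n⌉`. -/
def ell (n : ℕ) : ℕ := Nat.clog 2 n

/-- A way of choosing, by one coin flip, a random index `x ∈ {1, …, ℓ}` with
`Pr(x = i) = 2^{-i}` for `1 ≤ i < ℓ` and `Pr(x = ℓ) = 2^{-(ℓ-1)}`. -/
structure IndexChoice (n : ℕ) {Ω : Type*} (D : PMF Ω) where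
  x : Ω → ℕ
  one_le : ∀ c, 1 ≤ x c
  le_ell : ∀ c, x c ≤ ell n
  prob_of_lt : ∀ i, 1 ≤ i → i < ell n → D.map x i = (2⁻¹ : ℝ≥0∞) ^ i
  prob_ell : D.map x (ell n) = (2⁻¹ : ℝ≥0∞) ^ (ell n - 1)

/-- What a process that executes its own code does next: it has finished, or it flips a coin,
reads or writes one of the registers of the algorithm, or calls `elect()` on the group election
object, whose answer (`true` for win, `false` for lose) is all it learns from the call. -/
inductive Action (Ω Reg State : Type*) where
  | halt
  | flip (next : Ω → State)
  | read (r : Reg) (next : ℕ → State)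
  | write (r : Reg) (v : ℕ) (next : State)
  | elect (next : Bool → State)

/-- An algorithm for `n` processes that uses a group election object and registers `Reg`. -/
structure Algorithm (n : ℕ) (Ω Reg State : Type*) where
  initState : Fin n → State
  initMem : Reg → ℕ
  act : Fin n → State → Action Ω Reg State

/-- Local state of a process: running its own code, or inside the call of `elect()`, where it
has chosen the index `x` and continues with `next` once the call has returned. -/
inductive LocalState (State : Type*) where
  | main (s : State)
  | toWrite (x : ℕ) (next : Bool → State)
  | toFlip (x : ℕ) (next : Bool → State)
  | toRead (x : ℕ) (next : Bool → State)

/-- A shared register: one of the algorithm's, or `R[i]` of the group election object. -/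
inductive Loc (Reg : Type*) where
  | base (r : Reg)
  | R (i : ℕ)

/-- Kind of a step, with the affected register and the value returned or written. A finished
process that is scheduled executes a `noop`. -/
inductive Op (Ω Reg : Type*) where
  | flip (c : Ω)
  | read (l : Loc Reg) (v : ℕ)
  | write (l : Loc Reg) (v : ℕ)
  | noop

/-- Position of a step relative to the `elect()` call of its process: outside of the call, the
first step of the call, an inner step, or the last step, in which the call returns `b`. -/
inductive Tag where
  | outside
  | invoke
  | inner
  | ret (b : Bool)

/-- One step of an execution. -/
structure Step (n : ℕ) (Ω Reg : Type*) where
  pid : Fin n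
  op : Op Ω Reg
  tag : Tag

/-- A finite execution, in chronological order. -/
abbrev Execution (n : ℕ) (Ω Reg : Type*) := List (Step n Ω Reg)

/-- A configuration, together with the execution that led to it and the number of coin flips
in that execution. -/
structure Config (n : ℕ) (Ω Reg State : Type*) where
  loc : Fin n → LocalState State
  mem : Reg → ℕ
  R : ℕ → ℕ
  flips : ℕ
  trace : Execution n Ω Reg

section Semantics

variable {n : ℕ} {Ω Reg State : Type*} [DecidableEq Reg] {D : PMF Ω}

def Algorithm.init (M : Algorithm n Ω Reg State) : Config n Ω Reg State where
  loc p := .main (M.initState p)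
  mem := M.initMem
  R _ := 0
  flips := 0
  trace := []

/-- The next step, by process `p`, from configuration `C`, where `ω` is the coin flip vector.
The method `elect()` is:
choose `x` at random; `R[x].write(1)`; if `R[x+1].read() = 0` return win, else return lose.
Processes alternate between coin flips and shared memory steps, so that a coin flip whose value
is ignored stands between the write and the read. The algorithm's own code need not alternate. -/
def Algorithm.step (M : Algorithm n Ω Reg State) (ch : IndexChoice n D) (ω : ℕ → Ω)
    (C : Config n Ω Reg State) (p : Fin n) : Config n Ω Reg State :=
  let c := ω C.flips
  match C.loc p with
  | .main s =>
    match M.act p s with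
    | .halt => { C with trace := C.trace ++ [⟨p, .noop, .outside⟩] }
    | .flip next =>
      { C with
        loc := Function.update C.loc p (.main (next c))
        flips := C.flips + 1
        trace := C.trace ++ [⟨p, .flip c, .outside⟩] }
    | .read r next =>
      { C with
        loc := Function.update C.loc p (.main (next (C.mem r)))
        trace := C.trace ++ [⟨p, .read (.base r) (C.mem r), .outside⟩] }
    | .write r v next =>
      { C with
        loc := Function.update C.loc p (.main next)
        mem := Function.update C.mem r v
        trace := C.trace ++ [⟨p, .write (.base r) v, .outside⟩] }
    | .elect next =>
      { C with
        loc := Function.update C.loc p (.toWrite (ch.x c) next)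
        flips := C.flips + 1
        trace := C.trace ++ [⟨p, .flip c, .invoke⟩] }
  | .toWrite x next =>
    { C with
      loc := Function.update C.loc p (.toFlip x next)
      R := Function.update C.R x 1
      trace := C.trace ++ [⟨p, .write (.R x) 1, .inner⟩] }
  | .toFlip x next =>
    { C with
      loc := Function.update C.loc p (.toRead x next)
      flips := C.flips + 1
      trace := C.trace ++ [⟨p, .flip c, .inner⟩] }
  | .toRead x next =>
    let v := C.R (x + 1)
    let b : Bool := decide (v = 0)
    { C with
      loc := Function.update C.loc p (.main (next b))
      trace := C.trace ++ [⟨p, .read (.R (x + 1)) v, .ret b⟩] }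

/-- The configuration after the first `t` entries of the schedule `σ`, with coin flip
vector `ω`. -/
def Algorithm.run (M : Algorithm n Ω Reg State) (ch : IndexChoice n D) (σ : ℕ → Fin n)
    (ω : ℕ → Ω) : ℕ → Config n Ω Reg State
  | 0 => M.init
  | t + 1 => M.step ch ω (M.run ch σ ω t) (σ t)

/-- `C` results from a finite execution of `M`. -/
def Algorithm.Reachable (M : Algorithm n Ω Reg State) (ch : IndexChoice n D)
    (C : Config n Ω Reg State) : Prop :=
  ∃ (σ : ℕ → Fin n) (ω : ℕ → Ω) (t : ℕ), C = M.run ch σ ω t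

end Semantics

/-! ### Quantities of an execution -/

section Executions

variable {n : ℕ} {Ω Reg State : Type*}

def Op.isShared : Op Ω Reg → Bool
  | .read _ _ => true
  | .write _ _ => true
  | _ => false

def Op.coin : Op Ω Reg → Option Ω
  | .flip c => some c
  | _ => none

def Tag.isInvoke : Tag → Bool
  | .invoke => true
  | _ => false

def Tag.inCall : Tag → Bool
  | .outside => false
  | _ => true

/-- `p` participates: it invokes `elect()`. -/
def Participates (E : Execution n Ω Reg) (p : Fin n) : Prop :=
  ∃ s ∈ E, s.pid = p ∧ s.tag = .invoke

/-- The `elect()` call of `p` returns `b`. -/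
def Returns (E : Execution n Ω Reg) (p : Fin n) (b : Bool) : Prop :=
  ∃ s ∈ E, s.pid = p ∧ s.tag = .ret b

/-- Number of shared memory steps that `p` executes during its `elect()` call. -/
def electSteps (E : Execution n Ω Reg) (p : Fin n) : ℕ :=
  E.countP fun s => decide (s.pid = p) && s.op.isShared && s.tag.inCall

/-- Number of times that `p` invokes `elect()`. -/
def invocations (E : Execution n Ω Reg) (p : Fin n) : ℕ :=
  E.countP fun s => decide (s.pid = p) && s.tag.isInvoke

/-- Each process calls `elect()` at most once, in every execution of `M`. -/
def Algorithm.OneTime [DecidableEq Reg] {D : PMF Ω} (M : Algorithm n Ω Reg State)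
    (ch : IndexChoice n D) : Prop :=
  ∀ C, M.Reachable ch C → ∀ p, invocations C.trace p ≤ 1

/-- If at least one process participates and all participating processes finish their
`elect()` calls, then at least one process gets elected. -/
def GroupElectionProperty (E : Execution n Ω Reg) : Prop :=
  (∃ p, Participates E p) → (∀ p, Participates E p → ∃ b, Returns E p b) →
    ∃ p, Returns E p true

/-- Process `p` is poised to invoke `elect()`. -/
def Algorithm.Poised (M : Algorithm n Ω Reg State) (C : Config n Ω Reg State) (p : Fin n) : Prop :=
  ∃ s next, C.loc p = .main s ∧ M.act p s = .elect next

end Executions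

/-! ### Adversaries -/

section Adversaries

variable {n : ℕ} {Ω Reg State : Type*} [DecidableEq Reg] {D : PMF Ω}

/-- An adversary maps a finite execution to the process that takes the next step. -/
abbrev Adversary (n : ℕ) (Ω Reg : Type*) := Execution n Ω Reg → Fin n

/-- A pending shared memory step, without its register. -/
inductive Pending where
  | read
  | write (v : ℕ)

/-- The pending shared memory step of `p`; `none` if `p` has finished or its next step is a
coin flip. -/
def Algorithm.pending (M : Algorithm n Ω Reg State) (C : Config n Ω Reg State) (p : Fin n) :
    Option Pending :=
  match C.loc p with
  | .main s =>
    match M.act p s with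
    | .read _ _ => some .read
    | .write _ v _ => some (.write v)
    | _ => none
  | .toWrite _ _ => some (.write 1)
  | .toFlip _ _ => none
  | .toRead _ _ => some .read

/-- The values of the coin flips of `p` that precede its latest shared memory step. -/
def revealedCoins (E : Execution n Ω Reg) (p : Fin n) : List Ω :=
  ((E.filter fun s => decide (s.pid = p)).rdropWhile fun s => !s.op.isShared).filterMap
    fun s => s.op.coin

/-- `A` is location-oblivious for `M`: its decision depends only on the past schedule, on the
coin flips of each process that precede its latest shared memory step, and, for each process
whose next step is a shared memory step, on whether that step is a read or a write and, for a
write, on the value to be written. -/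
def LocationOblivious (M : Algorithm n Ω Reg State) (ch : IndexChoice n D)
    (A : Adversary n Ω Reg) : Prop :=
  ∀ C C', M.Reachable ch C → M.Reachable ch C' →
    C.trace.map Step.pid = C'.trace.map Step.pid →
    (∀ p, revealedCoins C.trace p = revealedCoins C'.trace p) →
    (∀ p, M.pending C p = M.pending C' p) →
    A C.trace = A C'.trace

/-- The configuration after `t` steps scheduled by `A`, with coin flip vector `ω`. -/
def Algorithm.exec (M : Algorithm n Ω Reg State) (ch : IndexChoice n D) (A : Adversary n Ω Reg)
    (ω : ℕ → Ω) : ℕ → Config n Ω Reg State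
  | 0 => M.init
  | t + 1 => M.step ch ω (M.exec ch A ω t) (A (M.exec ch A ω t).trace)

end Adversaries

/-! ### Max-contention, effectiveness, max-step complexity -/

noncomputable section Measures

variable {n : ℕ} {Ω Reg State : Type*} [DecidableEq Reg] {D : PMF Ω}

/-- The product distribution `D^∞` of the coin flip vector. -/
def coinMeasure [MeasurableSpace Ω] (D : PMF Ω) : Measure (ℕ → Ω) :=
  Measure.infinitePi fun _ => D.toMeasure

/-- Max-contention: the maximum number of processes that invoke `elect()` in an execution of
`M` that extends `E`. -/
def maxContention (M : Algorithm n Ω Reg State) (ch : IndexChoice n D)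
    (E : Execution n Ω Reg) : ℕ :=
  sSup {m | ∃ C, M.Reachable ch C ∧ E <+: C.trace ∧ m = {p | Participates C.trace p}.ncard}

/-- The event that the random execution of `M` scheduled by `A` is an extension of `E`. -/
def extends_ (M : Algorithm n Ω Reg State) (ch : IndexChoice n D) (A : Adversary n Ω Reg)
    (E : Execution n Ω Reg) : Set (ℕ → Ω) :=
  {ω | ∃ t, (M.exec ch A ω t).trace = E}

/-- The executions that can result (with positive probability) for adversary `A`, end when the
first process becomes poised to invoke `elect()`, and have max-contention at most `k`. -/
def startExecs [MeasurableSpace Ω] (M : Algorithm n Ω Reg State) (ch : IndexChoice n D)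
    (A : Adversary n Ω Reg) (k : ℕ) : Set (Execution n Ω Reg) :=
  {E | coinMeasure D (extends_ M ch A E) ≠ 0 ∧
    (∃ ω t, (M.exec ch A ω t).trace = E ∧ (∃ p, M.Poised (M.exec ch A ω t) p) ∧
      ∀ s < t, ∀ p, ¬ M.Poised (M.exec ch A ω s) p) ∧
    maxContention M ch E ≤ k}

/-- Number of processes that get elected in the execution of `M` scheduled by `A`. -/
def wins (M : Algorithm n Ω Reg State) (ch : IndexChoice n D) (A : Adversary n Ω Reg)
    (ω : ℕ → Ω) : ℕ :=
  {p | ∃ t, Returns (M.exec ch A ω t).trace p true}.ncard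

/-- Max-step complexity of `elect()` in the execution of `M` scheduled by `A`. -/
def maxSteps (M : Algorithm n Ω Reg State) (ch : IndexChoice n D) (A : Adversary n Ω Reg)
    (ω : ℕ → Ω) : ℝ≥0∞ :=
  ⨆ (p : Fin n) (t : ℕ), (electSteps (M.exec ch A ω t).trace p : ℝ≥0∞)

/-- Effectiveness of the group election object in `M` against `A`. -/
def effectiveness [MeasurableSpace Ω] (M : Algorithm n Ω Reg State) (ch : IndexChoice n D)
    (A : Adversary n Ω Reg) (k : ℕ) : ℝ≥0∞ :=
  ⨆ E ∈ startExecs M ch A k,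
    ∫⁻ ω, (wins M ch A ω : ℝ≥0∞) ∂(cond (coinMeasure D) (extends_ M ch A E))

/-- Adaptive expected max-step complexity of `elect()` in `M` against `A`. -/
def expectedMaxSteps [MeasurableSpace Ω] (M : Algorithm n Ω Reg State) (ch : IndexChoice n D)
    (A : Adversary n Ω Reg) (k : ℕ) : ℝ≥0∞ :=
  ⨆ E ∈ startExecs M ch A k,
    ∫⁻ ω, maxSteps M ch A ω ∂(cond (coinMeasure D) (extends_ M ch A E))

/-- The adaptive max-step complexity of `elect()` in `M` against `A` is bounded by `b k` with
probability `q k`. -/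
def MaxStepsBoundedWithProb [MeasurableSpace Ω] (M : Algorithm n Ω Reg State)
    (ch : IndexChoice n D) (A : Adversary n Ω Reg) (b q : ℕ → ℝ≥0∞) (k : ℕ) : Prop :=
  ∀ E ∈ startExecs M ch A k,
    q k ≤ cond (coinMeasure D) (extends_ M ch A E) {ω | maxSteps M ch A ω ≤ b k}

end Measures

end GroupElection

open GroupElection

namespace GroupElection

/-! ### Invariants of arbitrary executions: step counts, registers, termination. -/

section Invariants

variable {n : ℕ} {Ω Reg State : Type*}

/-! Group election: registers `R[j]` never return to 0, and a caller that wrote `R[x]` and loses has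
seen `R[x+1]` nonzero. If all calls had returned without a winner, nonzero registers would propagate
upwards forever, yet no index above `ell n` is ever written (`RegisterInvariant`). The step bound is
bookkeeping on calls (`Algorithm.Reachable.counts`).

Effectiveness: let `F` be the event that the execution extends `E`, and let `S i` be the expected
number, on `F`, of writes made in calls begun after `E` while `R[i+1]` is empty, whichever register
is written; it is the sum of the probabilities of `writeEvent`. A winner with index `i` makes such a
write. The event does not depend on the coin that chose the written register, since a
location-oblivious adversary cannot see that coin before the write takes place
(`update_mem_writeEvent`, `dependsOn_writeEvent`). By independence the expected number of winners on
`F` is at most `∑ S i * Pr(x = i)`. Also by independence, `S i * Pr(x = i+1)` is the expected number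
of those writes that go to `R[i+1]` itself; there is at most one, so this is at most `P(F)`.

Since `Pr(x = i+1) ≥ 2^{-(i+1)}`, each term with `i < ell n` is at most `2 P(F)`. Max-contention
gives `S i ≤ k P(F)`, so the term is also at most `k 2^{-i} P(F)`. The first bound for `i ≤ log k`
and the second beyond it sum to `(2 log k + 2) P(F)`; the term `i = ell n` adds at most `2 P(F)`,
because `k ≤ n ≤ 2^ell`. Dividing by `P(F)` gives the claim. -/

def Tag.isRet : Tag → Bool
  | .ret _ => true
  | _ => false

/-- Number of `elect()` calls of `p` that have returned. -/
def returned (E : Execution n Ω Reg) (p : Fin n) : ℕ :=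
  E.countP fun s => decide (s.pid = p) && s.tag.isRet

/-- Number of pending `elect()` calls of a process in the given local state. -/
def LocalState.openCalls : LocalState State → ℕ
  | .main _ => 0
  | _ => 1

/-- Number of shared memory steps executed so far in the pending `elect()` call. -/
def LocalState.callSteps : LocalState State → ℕ
  | .main _ => 0
  | .toWrite _ _ => 0
  | _ => 1

/-- Number of steps until the pending `elect()` call returns. -/
def LocalState.remaining : LocalState State → ℕ
  | .main _ => 0
  | .toWrite _ _ => 3
  | .toFlip _ _ => 2
  | .toRead _ _ => 1

lemma participates_iff_invocations_pos (E : Execution n Ω Reg) (p : Fin n) :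
    Participates E p ↔ 0 < invocations E p := by
  simp only [Participates, invocations, List.countP_pos_iff, Bool.and_eq_true, decide_eq_true_eq]
  refine exists_congr fun s => and_congr_right fun _ => and_congr_right fun _ => ?_
  cases s.tag <;> simp [Tag.isInvoke]

lemma exists_returns_iff_returned_pos (E : Execution n Ω Reg) (p : Fin n) :
    (∃ b, Returns E p b) ↔ 0 < returned E p := by
  simp only [Returns, returned, List.countP_pos_iff, Bool.and_eq_true, decide_eq_true_eq]
  constructor
  · rintro ⟨b, s, hs, hp, ht⟩
    exact ⟨s, hs, hp, by simp [ht, Tag.isRet]⟩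
  · rintro ⟨s, hs, hp, ht⟩
    cases h : s.tag <;> simp [h, Tag.isRet] at ht
    exact ⟨_, s, hs, hp, h⟩

lemma Participates.append {E : Execution n Ω Reg} {p : Fin n} (h : Participates E p)
    (F : Execution n Ω Reg) : Participates (E ++ F) p := by
  obtain ⟨s, hs, h⟩ := h
  exact ⟨s, List.mem_append_left _ hs, h⟩

lemma returns_concat_iff {E : Execution n Ω Reg} {st : Step n Ω Reg} {p : Fin n} {b : Bool} :
    Returns (E ++ [st]) p b ↔ Returns E p b ∨ (st.pid = p ∧ st.tag = .ret b) := by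
  simp [Returns, or_and_right, exists_or]

lemma invocations_concat (E : Execution n Ω Reg) (st : Step n Ω Reg) (p : Fin n) :
    invocations (E ++ [st]) p
      = invocations E p + if st.pid = p ∧ st.tag.isInvoke = true then 1 else 0 := by
  simp [invocations, List.countP_append, List.countP_cons]

lemma returned_concat (E : Execution n Ω Reg) (st : Step n Ω Reg) (p : Fin n) :
    returned (E ++ [st]) p
      = returned E p + if st.pid = p ∧ st.tag.isRet = true then 1 else 0 := by
  simp [returned, List.countP_append, List.countP_cons]

lemma electSteps_concat (E : Execution n Ω Reg) (st : Step n Ω Reg) (p : Fin n) :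
    electSteps (E ++ [st]) p
      = electSteps E p
        + if (st.pid = p ∧ st.op.isShared = true) ∧ st.tag.inCall = true then 1 else 0 := by
  simp [electSteps, List.countP_append, List.countP_cons]

variable [DecidableEq Reg] {D : PMF Ω}
variable (M : Algorithm n Ω Reg State) (ch : IndexChoice n D)

lemma Algorithm.step_trace (ω : ℕ → Ω) (C : Config n Ω Reg State) (p : Fin n) :
    ∃ st : Step n Ω Reg, (M.step ch ω C p).trace = C.trace ++ [st] ∧ st.pid = p := by
  unfold Algorithm.step
  split
  · split <;> exact ⟨_, rfl, rfl⟩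
  all_goals exact ⟨_, rfl, rfl⟩

lemma Algorithm.step_loc_of_ne (ω : ℕ → Ω) (C : Config n Ω Reg State) {p q : Fin n}
    (h : q ≠ p) : (M.step ch ω C p).loc q = C.loc q := by
  unfold Algorithm.step
  split
  · split <;> simp [h]
  all_goals simp [h]

lemma Algorithm.step_R_ne_zero (ω : ℕ → Ω) (C : Config n Ω Reg State) (p : Fin n) {j : ℕ}
    (h : C.R j ≠ 0) : (M.step ch ω C p).R j ≠ 0 := by
  unfold Algorithm.step
  split
  · split <;> simpa using h
  · simp only [Function.update_apply]
    split
    · simp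
    · exact h
  all_goals simpa using h

lemma Algorithm.flips_le_step (ω : ℕ → Ω) (C : Config n Ω Reg State) (p : Fin n) :
    C.flips ≤ (M.step ch ω C p).flips ∧ (M.step ch ω C p).flips ≤ C.flips + 1 := by
  unfold Algorithm.step
  split
  · split <;> simp
  all_goals simp

variable {M ch} in
lemma Algorithm.Reachable.induction {P : Config n Ω Reg State → Prop} (h0 : P M.init)
    (hs : ∀ C ω p, P C → P (M.step ch ω C p)) {C : Config n Ω Reg State}
    (hC : M.Reachable ch C) : P C := by
  obtain ⟨σ, ω, t, rfl⟩ := hC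
  induction t with
  | zero => exact h0
  | succ t ih => exact hs _ _ _ ih

variable {M ch} in
-- Every invocation is either pending or has returned, and a completed call has cost exactly one
-- write and one read.
lemma Algorithm.Reachable.counts {C : Config n Ω Reg State} (hC : M.Reachable ch C) :
    ∀ p, invocations C.trace p = returned C.trace p + (C.loc p).openCalls ∧
      electSteps C.trace p = 2 * returned C.trace p + (C.loc p).callSteps := by
  refine hC.induction (P := fun C => ∀ p, invocations C.trace p = returned C.trace p
    + (C.loc p).openCalls ∧ electSteps C.trace p = 2 * returned C.trace p + (C.loc p).callSteps)
    (fun p => ⟨rfl, rfl⟩) ?_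
  intro C ω q ih p
  obtain ⟨h1, h2⟩ := ih p
  by_cases hpq : p = q
  · subst hpq
    unfold Algorithm.step
    split <;> rename_i hl
    · split <;>
      simp [invocations_concat, returned_concat, electSteps_concat, Tag.isInvoke, Tag.isRet,
        Op.isShared, Tag.inCall, LocalState.openCalls, LocalState.callSteps, hl] at h1 h2 ⊢ <;>
      omega
    all_goals
      simp [invocations_concat, returned_concat, electSteps_concat, Tag.isInvoke, Tag.isRet,
        Op.isShared, Tag.inCall, LocalState.openCalls, LocalState.callSteps, hl] at h1 h2 ⊢
      omega
  · obtain ⟨st, hst, hp⟩ := M.step_trace ch ω C q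
    rw [M.step_loc_of_ne ch ω C hpq, hst, invocations_concat, returned_concat, electSteps_concat]
    have : st.pid ≠ p := fun h => hpq (h.symm.trans hp)
    simpa [this] using ⟨h1, h2⟩

/-- In every execution, each process executes at most two shared memory steps in `elect()`. -/
lemma electSteps_le_two {M : Algorithm n Ω Reg State} {ch : IndexChoice n D} (hM : M.OneTime ch)
    {C : Config n Ω Reg State} (hC : M.Reachable ch C) (p : Fin n) :
    electSteps C.trace p ≤ 2 := by
  obtain ⟨h1, h2⟩ := hC.counts p
  have h3 := hM C hC p
  cases h : C.loc p <;> simp [h, LocalState.openCalls, LocalState.callSteps] at h1 h2 <;> omega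

/-- The facts about the registers of the group election object that make it correct. -/
structure RegisterInvariant (n : ℕ) {Ω Reg State : Type*} (C : Config n Ω Reg State) : Prop where
  toWrite_le : ∀ p x next, C.loc p = .toWrite x next → x ≤ ell n
  le_ell : ∀ j, C.R j ≠ 0 → j ≤ ell n
  toFlip_ne : ∀ p x next, C.loc p = .toFlip x next → C.R x ≠ 0
  toRead_ne : ∀ p x next, C.loc p = .toRead x next → C.R x ≠ 0
  returns_ne : ∀ p b, Returns C.trace p b → ∃ j, C.R j ≠ 0
  successor : ∀ j, C.R j ≠ 0 → (∃ p next, C.loc p = .toFlip j next ∨ C.loc p = .toRead j next) ∨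
    C.R (j + 1) ≠ 0 ∨ ∃ p, Returns C.trace p true

variable {M ch} in
-- For `successor`, the critical step is the read: a caller leaving `toRead j` either saw `R[j+1]`
-- nonzero or returns win, so one of the other two alternatives takes over.
lemma Algorithm.Reachable.registerInvariant {C : Config n Ω Reg State} (hC : M.Reachable ch C) :
    RegisterInvariant n C := by
  refine hC.induction (P := RegisterInvariant n) ?_ ?_
  · constructor <;> simp [Algorithm.init, Returns]
  · intro C ω q ih
    obtain ⟨h1, h2, h3, h4, h5, h6⟩ := ih
    have hx := fun c => ch.le_ell c
    unfold Algorithm.step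
    split
    · split <;> constructor <;> simp only [Function.update_apply, returns_concat_iff] <;> grind
    · rename_i x next hl
      constructor <;> simp only [Function.update_apply, returns_concat_iff]
      case successor =>
        intro j hj
        by_cases hjx : j = x
        · exact .inl ⟨q, next, .inl (by simp [hjx])⟩
        rcases h6 j (by simpa [hjx] using hj) with ⟨p, next', h⟩ | h | ⟨p, h⟩
        · have : p ≠ q := by grind
          exact .inl ⟨p, next', by simpa [this] using h⟩
        · exact .inr (.inl (by split <;> simp [h]))
        · exact .inr (.inr ⟨p, .inl h⟩)
      all_goals grind
    all_goals
      constructor <;> simp only [Function.update_apply, returns_concat_iff] <;> grind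

variable {M ch} in
/-- If all participants have returned, and there is at least one, then somebody is elected. -/
lemma Algorithm.Reachable.groupElectionProperty (hM : M.OneTime ch) {C : Config n Ω Reg State}
    (hC : M.Reachable ch C) : GroupElectionProperty C.trace := by
  rintro ⟨p₀, hp₀⟩ hall
  obtain ⟨-, hle, -, -, hret, hsucc⟩ := hC.registerInvariant
  have hidle : ∀ p, (C.loc p).openCalls = 0 := by
    intro p
    have h1 := (hC.counts p).1
    have h2 := hM C hC p
    by_contra h
    have h3 := (exists_returns_iff_returned_pos _ _).1
      (hall p ((participates_iff_invocations_pos _ _).2 (by omega)))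
    omega
  by_contra hno
  have hnext : ∀ j, C.R j ≠ 0 → C.R (j + 1) ≠ 0 := by
    intro j hj
    rcases hsucc j hj with ⟨p, next, h | h⟩ | h | h
    · simpa [h, LocalState.openCalls] using hidle p
    · simpa [h, LocalState.openCalls] using hidle p
    · exact h
    · exact absurd h hno
  obtain ⟨b, hb⟩ := hall p₀ hp₀
  obtain ⟨j, hj⟩ := hret p₀ b hb
  -- The chain of nonzero registers climbs past `ell n`, which `hle` forbids.
  have : ∀ d, C.R (j + d) ≠ 0 := by
    intro d
    induction d with
    | zero => exact hj
    | succ d ih => exact hnext _ ih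
  have := hle _ (this (ell n + 1))
  omega

lemma reachable_run (σ : ℕ → Fin n) (ω : ℕ → Ω) (t : ℕ) : M.Reachable ch (M.run ch σ ω t) :=
  ⟨σ, ω, t, rfl⟩

/-- A call of `elect()` returns after three further steps of the caller. -/
lemma exists_returns_of_three_steps (σ : ℕ → Fin n) (ω : ℕ → Ω) (t t' : ℕ) (p : Fin n)
    (hp : Participates (M.run ch σ ω t).trace p)
    (h3 : 3 ≤ ((Finset.Ico t t').filter fun s => σ s = p).card) :
    ∃ b, Returns (M.run ch σ ω t').trace p b := by
  -- While the call is pending, each step of `p` lowers `remaining` by one, so its sum with the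
  -- number of steps taken stays at most 3.
  have key : ∀ d, 0 < returned (M.run ch σ ω (t + d)).trace p ∨
      (0 < ((M.run ch σ ω (t + d)).loc p).remaining ∧
      ((M.run ch σ ω (t + d)).loc p).remaining
        + ((Finset.Ico t (t + d)).filter fun s => σ s = p).card ≤ 3) := by
    intro d
    induction d with
    | zero =>
      have h1 := ((reachable_run M ch σ ω t).counts p).1
      have h2 := (participates_iff_invocations_pos _ _).1 hp
      cases h : (M.run ch σ ω t).loc p <;>
        simp [h, LocalState.openCalls, LocalState.remaining] at h1 ⊢ <;> omega
    | succ d ih =>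
      rw [← Nat.add_assoc, ← Finset.insert_Ico_right_eq_Ico_add_one (by omega), Finset.filter_insert]
      have hcard : t + d ∉ (Finset.Ico t (t + d)).filter fun s => σ s = p := by simp
      simp only [Algorithm.run]
      obtain ⟨st, hst, hpid⟩ := M.step_trace ch ω (M.run ch σ ω (t + d)) (σ (t + d))
      rcases ih with ih | ⟨ih0, ih⟩
      · left
        rw [hst, returned_concat]
        omega
      by_cases hσ : σ (t + d) = p
      · rw [if_pos hσ, Finset.card_insert_of_notMem hcard, hσ]
        generalize Finset.card _ = e at ih ⊢
        unfold Algorithm.step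
        split <;> rename_i hl <;>
          simp [hl, LocalState.remaining, returned_concat, Tag.isRet] at ih ih0 ⊢
        all_goals omega
      · rw [if_neg hσ, M.step_loc_of_ne ch ω _ (Ne.symm hσ)]
        exact Or.inr ⟨ih0, ih⟩
  have htt : t ≤ t' := by
    by_contra h
    rw [Finset.Ico_eq_empty (by omega)] at h3
    simp at h3
  have := key (t' - t)
  rw [Nat.add_sub_cancel' htt] at this
  rw [exists_returns_iff_returned_pos]
  omega

end Invariants

end GroupElection

namespace GroupElection

/-! ### Tracing a pending or won call back to its invocation and its write. -/

section History

variable {n : ℕ} {Ω Reg State : Type*} [DecidableEq Reg] {D : PMF Ω}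
variable (M : Algorithm n Ω Reg State) (ch : IndexChoice n D)

lemma Algorithm.step_trace_of_poised (ω : ℕ → Ω) {C : Config n Ω Reg State} {p : Fin n}
    (h : M.Poised C p) :
    (M.step ch ω C p).trace = C.trace ++ [⟨p, .flip (ω C.flips), .invoke⟩] := by
  obtain ⟨s, next, h1, h2⟩ := h
  simp [Algorithm.step, h1, h2]

lemma Algorithm.step_loc_of_poised (ω : ℕ → Ω) {C : Config n Ω Reg State} {p : Fin n}
    (h : M.Poised C p) :
    ∃ next, (M.step ch ω C p).loc p = .toWrite (ch.x (ω C.flips)) next := by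
  obtain ⟨s, next, h1, h2⟩ := h
  exact ⟨next, by simp [Algorithm.step, h1, h2]⟩

lemma Algorithm.poised_of_step_loc_eq_toWrite {ω : ℕ → Ω} {C : Config n Ω Reg State} {p : Fin n}
    {x : ℕ} {next : Bool → State} (h : (M.step ch ω C p).loc p = .toWrite x next) :
    M.Poised C p ∧ x = ch.x (ω C.flips) := by
  unfold Algorithm.step at h
  split at h
  · split at h <;> simp_all [Algorithm.Poised]
  all_goals simp_all

lemma Algorithm.loc_eq_toWrite_of_step {ω : ℕ → Ω} {C : Config n Ω Reg State} {p : Fin n}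
    {x : ℕ} {next : Bool → State} (h : (M.step ch ω C p).loc p = .toFlip x next) :
    C.loc p = .toWrite x next := by
  unfold Algorithm.step at h
  split at h
  · split at h <;> simp_all
  all_goals simp_all

lemma Algorithm.loc_eq_toFlip_of_step {ω : ℕ → Ω} {C : Config n Ω Reg State} {p : Fin n}
    {x : ℕ} {next : Bool → State} (h : (M.step ch ω C p).loc p = .toRead x next) :
    C.loc p = .toFlip x next := by
  unfold Algorithm.step at h
  split at h
  · split at h <;> simp_all
  all_goals simp_all

lemma Algorithm.returns_step {ω : ℕ → Ω} {C : Config n Ω Reg State} {p q : Fin n}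
    (h : Returns (M.step ch ω C q).trace p true) :
    Returns C.trace p true ∨ ∃ x next, C.loc p = .toRead x next ∧ C.R (x + 1) = 0 := by
  unfold Algorithm.step at h
  split at h
  · split at h <;> simp_all [returns_concat_iff]
  all_goals simp_all [returns_concat_iff]
  rcases h with h | ⟨rfl, h⟩
  · exact .inl h
  · exact .inr ⟨_, ⟨_, by assumption⟩, h⟩

variable (σ : ℕ → Fin n) (ω : ℕ → Ω)

lemma run_R_ne_zero {t t' : ℕ} (h : t ≤ t') {j : ℕ} (hj : (M.run ch σ ω t).R j ≠ 0) :
    (M.run ch σ ω t').R j ≠ 0 := by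
  induction t', h using Nat.le_induction with
  | base => exact hj
  | succ t' _ ih => exact M.step_R_ne_zero ch ω _ _ ih

lemma run_trace_prefix {t t' : ℕ} (h : t ≤ t') :
    (M.run ch σ ω t).trace <+: (M.run ch σ ω t').trace := by
  induction t', h using Nat.le_induction with
  | base => exact List.prefix_rfl
  | succ t' _ ih =>
    obtain ⟨st, hst, -⟩ := M.step_trace ch ω (M.run ch σ ω t') (σ t')
    exact ih.trans ⟨[st], hst.symm⟩

lemma run_trace_length (t : ℕ) : (M.run ch σ ω t).trace.length = t := by
  induction t with
  | zero => rfl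
  | succ t ih =>
    obtain ⟨st, hst, -⟩ := M.step_trace ch ω (M.run ch σ ω t) (σ t)
    simp only [Algorithm.run]
    rw [hst]
    simp [ih]

lemma run_flips_le (t : ℕ) : (M.run ch σ ω t).flips ≤ t := by
  induction t with
  | zero => exact le_rfl
  | succ t ih => exact (M.flips_le_step ch ω _ _).2.trans (by omega)

/-- The process scheduled at time `s` invokes `elect()` then, and writes at time `w` in that
call. -/
structure WritesAt (s w : ℕ) : Prop where
  lt : s < w
  poised : M.Poised (M.run ch σ ω s) (σ s)
  idle : ∀ u, s < u → u < w → σ u ≠ σ s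
  sched : σ w = σ s

variable {M ch σ ω}

/-- The caller takes no step strictly between `s` and `w`, so its local state is frozen from the
invocation on. -/
lemma WritesAt.loc_eq {s w : ℕ} (h : WritesAt M ch σ ω s w) :
    ∃ next, (M.run ch σ ω w).loc (σ w) = .toWrite (ch.x (ω (M.run ch σ ω s).flips)) next := by
  obtain ⟨next, hnext⟩ := M.step_loc_of_poised ch ω h.poised
  refine ⟨next, ?_⟩
  have : ∀ u, s + 1 ≤ u → u ≤ w →
      (M.run ch σ ω u).loc (σ s) = .toWrite (ch.x (ω (M.run ch σ ω s).flips)) next := by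
    intro u hu
    induction u, hu using Nat.le_induction with
    | base => exact fun _ => hnext
    | succ u hu ih =>
      intro huw
      rw [← ih (by omega)]
      exact M.step_loc_of_ne ch ω _ (h.idle u (by omega) (by omega)).symm
  rw [h.sched]
  exact this w h.lt le_rfl

lemma WritesAt.R_ne_zero {s w : ℕ} (h : WritesAt M ch σ ω s w) {t : ℕ} (ht : w < t) :
    (M.run ch σ ω t).R (ch.x (ω (M.run ch σ ω s).flips)) ≠ 0 := by
  obtain ⟨next, hnext⟩ := h.loc_eq
  refine run_R_ne_zero M ch σ ω (t := w + 1) ht ?_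
  simp [Algorithm.run, Algorithm.step, hnext]

lemma participates_of_poised {s : ℕ} (h : M.Poised (M.run ch σ ω s) (σ s)) {t : ℕ} (ht : s < t) :
    Participates (M.run ch σ ω t).trace (σ s) := by
  obtain ⟨F, hF⟩ := run_trace_prefix M ch σ ω (t := s + 1) ht
  rw [← hF]
  refine Participates.append ?_ F
  simp only [Algorithm.run]
  rw [M.step_trace_of_poised ch ω h]
  exact ⟨_, List.mem_append_right _ (List.mem_singleton_self _), rfl, rfl⟩

/-- In a one-time algorithm the invocation time is determined by the invoking process. -/
lemma eq_of_poised (hM : M.OneTime ch) {s s' : ℕ} (h : M.Poised (M.run ch σ ω s) (σ s))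
    (h' : M.Poised (M.run ch σ ω s') (σ s')) (hσ : σ s = σ s') : s = s' := by
  wlog hlt : s < s' generalizing s s'
  · rcases Nat.lt_trichotomy s s' with h1 | h1 | h1
    · exact absurd h1 hlt
    · exact h1
    · exact (this h' h hσ.symm h1).symm
  have h1 := hM _ (reachable_run M ch σ ω (s' + 1)) (σ s')
  have h2 := (participates_iff_invocations_pos _ _).1 (participates_of_poised h hlt)
  simp only [Algorithm.run] at h1
  rw [M.step_trace_of_poised ch ω h', invocations_concat] at h1
  simp [Tag.isInvoke] at h1
  rw [hσ] at h2
  omega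

lemma WritesAt.time_unique {s w w' : ℕ} (h : WritesAt M ch σ ω s w)
    (h' : WritesAt M ch σ ω s w') : w = w' := by
  rcases Nat.lt_trichotomy w w' with h1 | h1 | h1
  · exact absurd h.sched (h'.idle w h.lt h1)
  · exact h1
  · exact absurd h'.sched (h.idle w' h'.lt h1)

/-- The past of a process that is inside its `elect()` call. -/
lemma call_history (t : ℕ) : ∀ p,
    (∀ x next, (M.run ch σ ω t).loc p = .toWrite x next → ∃ s < t, σ s = p ∧
      M.Poised (M.run ch σ ω s) p ∧ (∀ u, s < u → u < t → σ u ≠ p) ∧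
      x = ch.x (ω (M.run ch σ ω s).flips)) ∧
    (∀ x next, (M.run ch σ ω t).loc p = .toFlip x next ∨ (M.run ch σ ω t).loc p = .toRead x next →
      ∃ s w, w < t ∧ σ s = p ∧ WritesAt M ch σ ω s w ∧
        x = ch.x (ω (M.run ch σ ω s).flips)) := by
  induction t with
  | zero => simp [Algorithm.run, Algorithm.init]
  | succ t ih =>
    intro p
    simp only [Algorithm.run]
    by_cases hp : p = σ t
    · subst hp
      refine ⟨fun x next h => ?_, fun x next h => ?_⟩
      · obtain ⟨h1, h2⟩ := M.poised_of_step_loc_eq_toWrite ch h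
        exact ⟨t, by omega, rfl, h1, fun u _ _ => by omega, h2⟩
      · rcases h with h | h
        · obtain ⟨s, hs, hσ, hpo, hidle, hx⟩ :=
            (ih _).1 x next (M.loc_eq_toWrite_of_step ch h)
          exact ⟨s, t, by omega, hσ, ⟨hs, hσ ▸ hpo, fun u h1 h2 => hσ ▸ hidle u h1 h2, hσ.symm⟩,
            hx⟩
        · obtain ⟨s, w, hw, h⟩ := (ih _).2 x next (.inl (M.loc_eq_toFlip_of_step ch h))
          exact ⟨s, w, by omega, h⟩
    · rw [M.step_loc_of_ne ch ω _ hp]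
      refine ⟨fun x next h => ?_, fun x next h => ?_⟩
      · obtain ⟨s, hs, hσ, hpo, hidle, hx⟩ := (ih _).1 x next h
        refine ⟨s, by omega, hσ, hpo, fun u h1 h2 => ?_, hx⟩
        rcases Nat.lt_succ_iff_lt_or_eq.1 h2 with h2 | rfl
        · exact hidle u h1 h2
        · exact Ne.symm hp
      · obtain ⟨s, w, hw, h⟩ := (ih _).2 x next h
        exact ⟨s, w, by omega, h⟩

/-- An elected process found, at the time of its write, the successor register empty. -/
lemma exists_writesAt_of_returns {t : ℕ} {p : Fin n}
    (h : Returns (M.run ch σ ω t).trace p true) :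
    ∃ s w, σ s = p ∧ WritesAt M ch σ ω s w ∧
      (M.run ch σ ω w).R (ch.x (ω (M.run ch σ ω s).flips) + 1) = 0 := by
  induction t with
  | zero => simp [Algorithm.run, Algorithm.init, Returns] at h
  | succ t ih =>
    rcases M.returns_step ch h with h | ⟨x, next, hl, hR⟩
    · exact ih h
    · obtain ⟨s, w, hw, hσ, hsw, rfl⟩ := (call_history t p).2 x next (.inr hl)
      refine ⟨s, w, hσ, hsw, ?_⟩
      -- Registers never become empty again, so one found empty by the read was empty at the earlier
      -- write.
      by_contra hne
      exact run_R_ne_zero M ch σ ω hw.le hne hR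

end History

/-! ### Changing the coin behind a pending write is invisible to the adversary. -/

section Swap

variable {n : ℕ} {Ω Reg State : Type*}

/-- `C'` differs from `C` only in the coin flip of `p` that determines the register of its
pending write in `elect()`. -/
def CoinSwap (p : Fin n) (C C' : Config n Ω Reg State) : Prop :=
  ∃ E₁ E₂ c c' x x' next, C.loc p = .toWrite x next ∧
    C.trace = E₁ ++ ⟨p, .flip c, .invoke⟩ :: E₂ ∧ (∀ st ∈ E₂, st.pid ≠ p) ∧
    C' = { C with
      loc := Function.update C.loc p (.toWrite x' next)
      trace := E₁ ++ ⟨p, .flip c', .invoke⟩ :: E₂ }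

lemma CoinSwap.R_eq {p : Fin n} {C C' : Config n Ω Reg State} (h : CoinSwap p C C') :
    C'.R = C.R := by
  obtain ⟨_, _, _, _, _, _, _, _, _, _, rfl⟩ := h
  rfl

/-- The flip follows the latest shared memory step of `p`, so `rdropWhile` discards it. -/
lemma revealedCoins_of_pending_flip (p : Fin n) (E₁ E₂ : Execution n Ω Reg) (c : Ω) (tg : Tag)
    (h : ∀ st ∈ E₂, st.pid ≠ p) :
    revealedCoins (E₁ ++ ⟨p, .flip c, tg⟩ :: E₂) p = revealedCoins E₁ p := by
  have : E₂.filter (fun s => decide (s.pid = p)) = [] := by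
    simpa [List.filter_eq_nil_iff] using h
  simp only [revealedCoins, List.filter_append, List.filter_cons, decide_true, if_true, this]
  rw [List.rdropWhile_concat_pos _ _ _ (by simp [Op.isShared])]

variable [DecidableEq Reg] {D : PMF Ω} {M : Algorithm n Ω Reg State} {ch : IndexChoice n D}

/-- A location-oblivious adversary does not see the difference. -/
lemma CoinSwap.adversary_eq {A : Adversary n Ω Reg} (hA : LocationOblivious M ch A) {p : Fin n}
    {C C' : Config n Ω Reg State} (hC : M.Reachable ch C) (hC' : M.Reachable ch C')
    (h : CoinSwap p C C') : A C'.trace = A C.trace := by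
  refine (hA C C' hC hC' ?_ ?_ ?_).symm
  all_goals obtain ⟨E₁, E₂, c, c', x, x', next, hl, htr, hE, rfl⟩ := h
  · simp [htr]
  · intro q
    by_cases hq : q = p
    · subst hq
      rw [htr, revealedCoins_of_pending_flip _ _ _ _ _ hE,
        revealedCoins_of_pending_flip _ _ _ _ _ hE]
    · have : p ≠ q := Ne.symm hq
      simp [htr, revealedCoins, this]
  · intro q
    by_cases hq : q = p
    · subst hq
      -- Both pending steps write the value 1; the index differs, but `Pending` does not record it.
      simp [Algorithm.pending, hl]
    · simp [Algorithm.pending, hq]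

/-- The difference persists while `p` takes no steps. -/
lemma CoinSwap.step {p q : Fin n} (hq : q ≠ p) {ω ω' : ℕ → Ω} {C C' : Config n Ω Reg State}
    (hω : ω C.flips = ω' C.flips) (h : CoinSwap p C C') :
    CoinSwap p (M.step ch ω C q) (M.step ch ω' C' q) := by
  obtain ⟨E₁, E₂, c, c', x, x', next, hl, htr, hE, rfl⟩ := h
  obtain ⟨st, hst, hpid⟩ := M.step_trace ch ω C q
  refine ⟨E₁, E₂ ++ [st], c, c', x, x', next, ?_, ?_, ?_, ?_⟩
  · rw [M.step_loc_of_ne ch ω C hq.symm, hl]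
  · rw [hst, htr]
    simp
  · intro st' h
    rcases List.mem_append.1 h with h | h
    · exact hE _ h
    · rw [List.mem_singleton.1 h, hpid]
      exact hq
  -- Since `q ≠ p`, the step of `q` sees the same local state, memory and coin on both sides, and
  -- its update commutes with that of `p`.
  · unfold Algorithm.step at hst ⊢
    simp only [Function.update_of_ne hq]
    split at hst
    · split at hst <;>
      · simp only [List.append_cancel_left_eq, List.cons.injEq, and_true] at hst
        subst hst
        simp [*, Function.update_comm hq]
    all_goals
      simp only [List.append_cancel_left_eq, List.cons.injEq, and_true] at hst
      subst hst
      simp [*, Function.update_comm hq]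

/-- This is where a swap originates: right after the invocation, the part of the trace behind the
flip is empty. -/
lemma coinSwap_step_of_poised {p : Fin n} {ω ω' : ℕ → Ω} {C : Config n Ω Reg State}
    (h : M.Poised C p) : CoinSwap p (M.step ch ω C p) (M.step ch ω' C p) := by
  obtain ⟨s, next, h1, h2⟩ := h
  refine ⟨C.trace, [], ω C.flips, ω' C.flips, ch.x (ω C.flips), ch.x (ω' C.flips), next, ?_⟩
  simp [Algorithm.step, h1, h2]

end Swap

end GroupElection

namespace GroupElection

/-! ### Executions driven by an adversary, and which coins the events depend on. -/

section ExecutionsOfAdversary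

variable {n : ℕ} {Ω Reg State : Type*} [DecidableEq Reg] {D : PMF Ω}
variable (M : Algorithm n Ω Reg State) (ch : IndexChoice n D) (A : Adversary n Ω Reg)

/-- The schedule that `A` generates for the coin flip vector `ω`. -/
def schedule (ω : ℕ → Ω) (t : ℕ) : Fin n := A (M.exec ch A ω t).trace

lemma exec_eq_run (ω : ℕ → Ω) (t : ℕ) :
    M.exec ch A ω t = M.run ch (schedule M ch A ω) ω t := by
  induction t with
  | zero => rfl
  | succ t ih => simp only [Algorithm.exec, Algorithm.run, ← ih, schedule]

lemma reachable_exec (ω : ℕ → Ω) (t : ℕ) : M.Reachable ch (M.exec ch A ω t) :=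
  ⟨_, ω, t, exec_eq_run M ch A ω t⟩

lemma exec_trace_length (ω : ℕ → Ω) (t : ℕ) : (M.exec ch A ω t).trace.length = t := by
  rw [exec_eq_run, run_trace_length]

lemma exec_trace_prefix (ω : ℕ → Ω) {t t' : ℕ} (h : t ≤ t') :
    (M.exec ch A ω t).trace <+: (M.exec ch A ω t').trace := by
  rw [exec_eq_run, exec_eq_run]
  exact run_trace_prefix M ch _ ω h

lemma exec_flips_mono (ω : ℕ → Ω) : Monotone fun t => (M.exec ch A ω t).flips :=
  monotone_nat_of_le_succ fun _ => (M.flips_le_step ch ω _ _).1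

lemma exec_flips_le (ω : ℕ → Ω) (t : ℕ) : (M.exec ch A ω t).flips ≤ t := by
  rw [exec_eq_run]
  exact run_flips_le M ch _ ω t

lemma Algorithm.step_congr {ω ω' : ℕ → Ω} {C : Config n Ω Reg State} {p : Fin n}
    (h : ∀ i < (M.step ch ω C p).flips, ω i = ω' i) : M.step ch ω C p = M.step ch ω' C p := by
  unfold Algorithm.step at h ⊢
  split at h
  · split at h <;> simp_all
  all_goals simp_all

/-- Coins not yet consumed influence neither the configuration nor, through the trace, the choices
of the adversary. -/
lemma exec_congr {ω ω' : ℕ → Ω} {t : ℕ} (h : ∀ i < (M.exec ch A ω t).flips, ω i = ω' i) :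
    M.exec ch A ω t = M.exec ch A ω' t := by
  induction t with
  | zero => rfl
  | succ t ih =>
    have := ih fun i hi => h i (hi.trans_le (exec_flips_mono M ch A ω t.le_succ))
    simp only [Algorithm.exec] at h ⊢
    rw [← this]
    exact M.step_congr ch h

/-- The trace records the value of each flip, so equal traces force equal consumed coins. -/
lemma Algorithm.step_eq_of_trace_eq {ω ω' : ℕ → Ω} {C : Config n Ω Reg State} {p : Fin n}
    (h : (M.step ch ω C p).trace = (M.step ch ω' C p).trace) :
    M.step ch ω C p = M.step ch ω' C p := by
  unfold Algorithm.step at h ⊢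
  split at h
  · split at h <;> simp_all
  all_goals simp_all

/-- The configuration is determined by the execution that led to it. -/
lemma exec_eq_of_trace_eq {ω ω' : ℕ → Ω} {t : ℕ}
    (h : (M.exec ch A ω t).trace = (M.exec ch A ω' t).trace) :
    M.exec ch A ω t = M.exec ch A ω' t := by
  induction t with
  | zero => rfl
  | succ t ih =>
    have ht : (M.exec ch A ω t).trace = (M.exec ch A ω' t).trace := by
      simp only [Algorithm.exec] at h
      obtain ⟨st, hst, -⟩ := M.step_trace ch ω (M.exec ch A ω t) (A (M.exec ch A ω t).trace)
      obtain ⟨st', hst', -⟩ := M.step_trace ch ω' (M.exec ch A ω' t) (A (M.exec ch A ω' t).trace)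
      rw [hst, hst'] at h
      exact (List.append_inj' h rfl).1
    have := ih ht
    simp only [Algorithm.exec] at h ⊢
    rw [← this] at h ⊢
    exact M.step_eq_of_trace_eq ch h

/-- Every step, even a no-op, adds one trace entry, so `E` can only occur at time `E.length`. -/
lemma mem_extends_iff {E : Execution n Ω Reg} {ω : ℕ → Ω} :
    ω ∈ extends_ M ch A E ↔ (M.exec ch A ω E.length).trace = E := by
  constructor
  · rintro ⟨t, rfl⟩
    rw [exec_trace_length]
  · exact fun h => ⟨_, h⟩

/-- The execution extends `E`; the coin flip of index `m` takes place at time `s`, at or after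
the end of `E`, in an invocation of `elect()`; and the invoking process writes at time `w`, when
`R[i+1]` is still empty. Here `j = (m, s, w)`. -/
def writeEvent (E : Execution n Ω Reg) (i : ℕ) (j : ℕ × ℕ × ℕ) : Set (ℕ → Ω) :=
  {ω | E.length ≤ j.2.1 ∧ ω ∈ extends_ M ch A E ∧ (M.exec ch A ω j.2.1).flips = j.1 ∧
    WritesAt M ch (schedule M ch A ω) ω j.2.1 j.2.2 ∧ (M.exec ch A ω j.2.2).R (i + 1) = 0}

variable {M ch A}

/-- Between `s` and `w` only the schedule matters, and at `w` only the registers `R`. Local states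
and traces may differ after `s`, which leaves room for the coin swap. -/
lemma mem_writeEvent_of_agree {E : Execution n Ω Reg} {i : ℕ} {j : ℕ × ℕ × ℕ} {ω ω' : ℕ → Ω}
    (hexec : ∀ u ≤ j.2.1, M.exec ch A ω u = M.exec ch A ω' u)
    (hsched : ∀ u ≤ j.2.2, schedule M ch A ω u = schedule M ch A ω' u)
    (hR : (M.exec ch A ω j.2.2).R = (M.exec ch A ω' j.2.2).R)
    (h : ω ∈ writeEvent M ch A E i j) : ω' ∈ writeEvent M ch A E i j := by
  obtain ⟨h1, h2, h3, ⟨h4, h5, h6, h7⟩, h8⟩ := h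
  refine ⟨h1, ?_, ?_, ⟨h4, ?_, ?_, ?_⟩, ?_⟩
  · rw [mem_extends_iff] at h2 ⊢
    rw [← hexec _ h1, h2]
  · rw [← hexec _ le_rfl, h3]
  · rw [← exec_eq_run] at h5 ⊢
    rwa [← hexec _ le_rfl, ← hsched _ h4.le]
  · intro u hu hu'
    rw [← hsched _ hu'.le, ← hsched _ h4.le]
    exact h6 u hu hu'
  · rw [← hsched _ le_rfl, ← hsched _ h4.le, h7]
  · rw [← hR, h8]

/-- The index chosen by a process has no influence until the process writes. -/
lemma update_mem_writeEvent (hA : LocationOblivious M ch A) {E : Execution n Ω Reg} {i : ℕ}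
    {j : ℕ × ℕ × ℕ} {ω : ℕ → Ω} (h : ω ∈ writeEvent M ch A E i j) (c : Ω) :
    Function.update ω j.1 c ∈ writeEvent M ch A E i j := by
  obtain ⟨-, -, hm, ⟨hsw, hpo, hidle, -⟩, -⟩ := id h
  obtain ⟨m, s, w⟩ := j
  dsimp only at *
  rw [← exec_eq_run] at hpo
  set ω' := Function.update ω m c with hω'
  have hexec : ∀ u ≤ s, M.exec ch A ω u = M.exec ch A ω' u := by
    intro u hu
    refine exec_congr M ch A fun i hi => ?_
    have : (M.exec ch A ω u).flips ≤ m := hm ▸ exec_flips_mono M ch A ω hu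
    rw [hω', Function.update_of_ne (by omega)]
  -- From the invocation to the write the two executions differ by a swap only; coin `m` is already
  -- spent, so both consume the same later coins.
  have hswap : ∀ u, s + 1 ≤ u → u ≤ w →
      CoinSwap (schedule M ch A ω s) (M.exec ch A ω u) (M.exec ch A ω' u) ∧
      m < (M.exec ch A ω u).flips := by
    intro u hu
    induction u, hu using Nat.le_induction with
    | base =>
      refine fun _ => ⟨?_, ?_⟩
      · have := coinSwap_step_of_poised (ch := ch) (ω := ω) (ω' := ω') hpo
        simpa only [Algorithm.exec, ← hexec s le_rfl, schedule] using this
      · obtain ⟨st, next, h1, h2⟩ := hpo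
        simp only [schedule] at h1 h2
        simp [Algorithm.exec, Algorithm.step, h1, h2, hm]
    | succ u hu ih =>
      intro huw
      obtain ⟨ih, hflips⟩ := ih (by omega)
      refine ⟨?_, hflips.trans_le (exec_flips_mono M ch A ω u.le_succ)⟩
      have hq := hidle u (by omega) (by omega)
      simp only [Algorithm.exec]
      rw [ih.adversary_eq hA (reachable_exec M ch A ω u) (reachable_exec M ch A ω' u)]
      exact ih.step hq (by rw [hω', Function.update_of_ne (by omega)])
  refine mem_writeEvent_of_agree hexec (fun u hu => ?_) ?_ h
  · by_cases hus : u ≤ s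
    · simp only [schedule, hexec u hus]
    · exact ((hswap u (by omega) hu).1.adversary_eq hA (reachable_exec M ch A ω u)
        (reachable_exec M ch A ω' u)).symm
  · exact ((hswap w hsw le_rfl).1.R_eq).symm

lemma dependsOn_extends (E : Execution n Ω Reg) :
    DependsOn (fun ω => ω ∈ extends_ M ch A E) (Finset.range E.length : Set ℕ) := by
  intro ω ω' h
  have : M.exec ch A ω E.length = M.exec ch A ω' E.length :=
    exec_congr M ch A fun i hi =>
      h i (by simpa using hi.trans_le (exec_flips_le M ch A ω _))
  simp only [mem_extends_iff, this]

/-- By time `w` only coins of index below `w` are consumed. Coin `j.1` is first replaced by that of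
the other vector, at no cost by `update_mem_writeEvent`; then the vectors agree on all consumed
coins. -/
lemma dependsOn_writeEvent (hA : LocationOblivious M ch A) (E : Execution n Ω Reg) (i : ℕ)
    (j : ℕ × ℕ × ℕ) :
    DependsOn (fun ω => ω ∈ writeEvent M ch A E i j)
      ((Finset.range j.2.2).erase j.1 : Finset ℕ) := by
  have main : ∀ ω ω' : ℕ → Ω,
      (∀ k ∈ (((Finset.range j.2.2).erase j.1 : Finset ℕ) : Set ℕ), ω k = ω' k) →
      ω ∈ writeEvent M ch A E i j → ω' ∈ writeEvent M ch A E i j := by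
    intro ω ω' h hω
    have h' := update_mem_writeEvent hA hω (ω' j.1)
    have hexec : ∀ u ≤ j.2.2,
        M.exec ch A (Function.update ω j.1 (ω' j.1)) u = M.exec ch A ω' u := by
      intro u hu
      refine exec_congr M ch A fun k hk => ?_
      have hk' := hk.trans_le (exec_flips_le M ch A _ _)
      by_cases hkm : k = j.1
      · simp [hkm]
      · rw [Function.update_of_ne hkm]
        exact h k (by simp [hkm]; omega)
    refine mem_writeEvent_of_agree (fun u hu => hexec u ?_) (fun u hu => ?_) ?_ h'
    · exact hu.trans hω.2.2.2.1.lt.le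
    · simp only [schedule, hexec u hu]
    · rw [hexec _ le_rfl]
  intro ω ω' h
  exact propext ⟨main ω ω' h, main ω' ω fun k hk => (h k hk).symm⟩

end ExecutionsOfAdversary

/-! ### Cylinder events and independence of a single coin. -/

section Probability

variable {Ω : Type*}

/-- Writing the event as a cylinder gives both its measurability and its independence of coins
outside `I`. -/
lemma eq_preimage_restrict_of_dependsOn {G : Set (ℕ → Ω)} {I : Finset ℕ}
    (h : DependsOn (fun ω => ω ∈ G) (I : Set ℕ)) :
    G = (fun (ω : ℕ → Ω) (i : I) => ω i) ⁻¹' ((fun (ω : ℕ → Ω) (i : I) => ω i) '' G) := by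
  refine (Set.subset_preimage_image _ _).antisymm ?_
  rintro ω ⟨ω', hω', he⟩
  exact (h (x := ω') (y := ω) fun i hi => congrFun he ⟨i, hi⟩).mp hω'

variable [MeasurableSpace Ω]

instance isProbabilityMeasure_coinMeasure (D : PMF Ω) : IsProbabilityMeasure (coinMeasure D) :=
  inferInstanceAs (IsProbabilityMeasure (Measure.infinitePi fun _ => D.toMeasure))

variable [DiscreteMeasurableSpace Ω] [Countable Ω]

/-- The base of the cylinder lies in a finite power of the countable `Ω`, where every set is
countable and hence measurable. -/
lemma measurableSet_of_dependsOn {G : Set (ℕ → Ω)} {I : Finset ℕ}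
    (h : DependsOn (fun ω => ω ∈ G) (I : Set ℕ)) : MeasurableSet G := by
  rw [eq_preimage_restrict_of_dependsOn h]
  exact (measurable_pi_lambda _ fun i => measurable_pi_apply _) (Set.to_countable _).measurableSet

/-- A coin flip is independent of an event that does not depend on it. -/
lemma coinMeasure_inter_of_dependsOn (D : PMF Ω) {G : Set (ℕ → Ω)} {I : Finset ℕ}
    (h : DependsOn (fun ω => ω ∈ G) (I : Set ℕ)) {m : ℕ} (hm : m ∉ I) (x : Ω → ℕ) (i : ℕ) :
    coinMeasure D (G ∩ {ω | x (ω m) = i}) = coinMeasure D G * D.map x i := by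
  have hind : iIndepFun (fun (k : ℕ) (ω : ℕ → Ω) => ω k) (coinMeasure D) :=
    iIndepFun_infinitePi (P := fun _ => D.toMeasure) (X := fun _ c => c) fun _ => measurable_id
  have hind := hind.indepFun_finset I {m} (by simpa using hm) fun k => measurable_pi_apply k
  have hset : {ω : ℕ → Ω | x (ω m) = i}
      = (fun (ω : ℕ → Ω) (k : ({m} : Finset ℕ)) => ω k) ⁻¹'
        {f | x (f ⟨m, Finset.mem_singleton_self m⟩) = i} := rfl
  have hval : coinMeasure D {ω | x (ω m) = i} = D.map x i := by
    have := (measurePreserving_eval_infinitePi (fun _ : ℕ => D.toMeasure) m).measure_preimage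
      (s := x ⁻¹' {i}) (MeasurableSet.of_discrete.nullMeasurableSet)
    rw [← PMF.toMeasure_apply_singleton (D.map x) i (measurableSet_singleton i),
      PMF.toMeasure_map_apply _ _ _ (measurable_of_countable x) (measurableSet_singleton i)]
    exact this
  rw [← hval, hset]
  conv_lhs => rw [eq_preimage_restrict_of_dependsOn h]
  rw [hind.measure_inter_preimage_eq_mul _ _ (Set.to_countable _).measurableSet
    (Set.to_countable _).measurableSet, ← eq_preimage_restrict_of_dependsOn h]

end Probability

/-! ### Expected numbers of events as sums of probabilities. -/

section Counting

variable {X ι : Type*}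

lemma tsum_indicator_one_eq_encard (B : ι → Set X) (ω : X) :
    ∑' j, (B j).indicator (fun _ => (1 : ℝ≥0∞)) ω = ({j | ω ∈ B j}.encard : ℝ≥0∞) := by
  rw [← ENNReal.tsum_set_one, tsum_subtype {j | ω ∈ B j} fun _ => (1 : ℝ≥0∞)]
  rfl

variable [MeasurableSpace X] [Countable ι]

lemma lintegral_encard_eq_tsum (μ : Measure X) {B : ι → Set X} (hB : ∀ j, MeasurableSet (B j)) :
    ∫⁻ ω, ({j | ω ∈ B j}.encard : ℝ≥0∞) ∂μ = ∑' j, μ (B j) := by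
  simp_rw [← tsum_indicator_one_eq_encard]
  rw [lintegral_tsum fun j => (measurable_const.indicator (hB j)).aemeasurable]
  simp [lintegral_indicator, hB]

/-- If at most `k` of the events `B j`, all contained in `F`, occur at the same time, then their
probabilities sum up to at most `k` times the probability of `F`. -/
lemma tsum_measure_le (μ : Measure X) {B : ι → Set X} (hB : ∀ j, MeasurableSet (B j)) {F : Set X}
    (hF : MeasurableSet F) (hsub : ∀ j, B j ⊆ F) {k : ℕ}
    (hk : ∀ ω ∈ F, {j | ω ∈ B j}.encard ≤ k) : ∑' j, μ (B j) ≤ k * μ F := by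
  rw [← lintegral_encard_eq_tsum μ hB, ← lintegral_indicator_const hF]
  refine lintegral_mono fun ω => ?_
  by_cases hω : ω ∈ F
  · rw [Set.indicator_of_mem hω]
    exact (ENat.toENNReal_mono (hk ω hω)).trans_eq (by simp)
  · have : {j | ω ∈ B j} = ∅ := by
      ext j
      simpa using fun h => hω (hsub j h)
    simp [this]

end Counting

end GroupElection

namespace GroupElection

/-! ### The bound on the expected number of winners. -/

section Effectiveness

variable {n : ℕ} {Ω Reg State : Type*} [DecidableEq Reg] {D : PMF Ω}
variable {M : Algorithm n Ω Reg State} {ch : IndexChoice n D} {A : Adversary n Ω Reg}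

lemma ncard_participates_le (E : Execution n Ω Reg) {C : Config n Ω Reg State}
    (hC : M.Reachable ch C) (hE : E <+: C.trace) :
    {p | Participates C.trace p}.ncard ≤ maxContention M ch E := by
  -- `sSup` in `ℕ` is a true supremum only for bounded sets; here the number `n` of processes is a
  -- bound.
  refine le_csSup ⟨n, ?_⟩ ⟨C, hC, hE, rfl⟩
  rintro m ⟨C', -, -, rfl⟩
  simpa using Set.ncard_le_ncard (Set.subset_univ {p | Participates C'.trace p})

/-- The processes that write after `E` are at most as many as the max-contention of `E`. -/
lemma encard_writeEvent_le (hM : M.OneTime ch) (E : Execution n Ω Reg) (i : ℕ) {ω : ℕ → Ω}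
    (hω : ω ∈ extends_ M ch A E) :
    {j | ω ∈ writeEvent M ch A E i j}.encard ≤ maxContention M ch E := by
  set σ := schedule M ch A ω with hσ
  -- There are finitely many processes, so one finite execution already contains all participants of
  -- the infinite one.
  have hpart : ∃ N, E.length ≤ N ∧ ∀ p, (∃ t, Participates (M.exec ch A ω t).trace p) →
      Participates (M.exec ch A ω N).trace p := by
    have : ∀ p, ∃ N, (∃ t, Participates (M.exec ch A ω t).trace p) →
        Participates (M.exec ch A ω N).trace p := by
      intro p
      by_cases h : ∃ t, Participates (M.exec ch A ω t).trace p
      · exact ⟨h.choose, fun _ => h.choose_spec⟩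
      · exact ⟨0, fun h' => absurd h' h⟩
    choose N hN using this
    refine ⟨max E.length (Finset.univ.sup N), le_max_left _ _, fun p hp => ?_⟩
    obtain ⟨F, hF⟩ := exec_trace_prefix M ch A ω (t := N p)
      (t' := max E.length (Finset.univ.sup N))
      ((Finset.le_sup (Finset.mem_univ p)).trans (le_max_right _ _))
    rw [← hF]
    exact (hN p hp).append F
  obtain ⟨N, hEN, hN⟩ := hpart
  have hpre : E <+: (M.exec ch A ω N).trace := by
    have := exec_trace_prefix M ch A ω hEN
    rwa [(mem_extends_iff M ch A).1 hω] at this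
  have hcard := ncard_participates_le E (reachable_exec M ch A ω N) hpre
  refine le_trans ?_ (Nat.cast_le.2 hcard)
  rw [(Set.toFinite _).cast_ncard_eq]
  -- A triple is determined by its process: one-time use fixes `s`, and `s` fixes both `m` and `w`.
  refine Set.encard_le_encard_of_injOn (f := fun j => σ j.2.1) ?_ ?_
  · rintro ⟨m, s, w⟩ ⟨-, -, -, h, -⟩
    refine hN _ ⟨s + 1, ?_⟩
    rw [exec_eq_run]
    exact participates_of_poised h.poised (Nat.lt_succ_self s)
  · rintro ⟨m, s, w⟩ ⟨-, -, hm, h, -⟩ ⟨m', s', w'⟩ ⟨-, -, hm', h', -⟩ heq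
    dsimp only at *
    obtain rfl := eq_of_poised hM h.poised h'.poised heq
    obtain rfl := h.time_unique h'
    rw [← hm, ← hm']

/-- At most one process finds `R[i+1]` empty when it writes to that register. -/
lemma encard_first_write_le_one (hM : M.OneTime ch) (E : Execution n Ω Reg) (i : ℕ) (ω : ℕ → Ω) :
    {j | ω ∈ writeEvent M ch A E i j ∩ {ω | ch.x (ω j.1) = i + 1}}.encard ≤ 1 := by
  -- A write to `R[i+1]` at time `w` leaves it nonempty at every later `w'`.
  have key : ∀ {m s w m' s' w' : ℕ},
      ω ∈ writeEvent M ch A E i (m, s, w) ∩ {ω | ch.x (ω m) = i + 1} →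
      ω ∈ writeEvent M ch A E i (m', s', w') → ¬ w < w' := by
    rintro m s w m' s' w' ⟨⟨-, -, hm, h, -⟩, hx⟩ ⟨-, -, -, -, hR⟩ hlt
    have := h.R_ne_zero hlt
    rw [← exec_eq_run, ← exec_eq_run] at this
    dsimp only at hm hR
    rw [hm, show ch.x (ω m) = i + 1 from hx] at this
    exact this hR
  rw [Set.encard_le_one_iff]
  rintro ⟨m, s, w⟩ ⟨m', s', w'⟩ hj hj'
  obtain rfl : w = w' := le_antisymm (not_lt.1 (key hj' hj.1)) (not_lt.1 (key hj hj'.1))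
  obtain ⟨-, -, hm, h, -⟩ := hj.1
  obtain ⟨-, -, hm', h', -⟩ := hj'.1
  dsimp only at *
  obtain rfl := eq_of_poised hM h.poised h'.poised (h.sched.symm.trans h'.sched)
  rw [← hm, ← hm']

/-- Each elected process is accounted for by a write event. -/
lemma wins_le_encard {E : Execution n Ω Reg} {ω₀ : ℕ → Ω}
    (hE : (M.exec ch A ω₀ E.length).trace = E)
    (hfirst : ∀ s < E.length, ∀ p, ¬ M.Poised (M.exec ch A ω₀ s) p) {ω : ℕ → Ω}
    (hω : ω ∈ extends_ M ch A E) :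
    (wins M ch A ω : ℕ∞) ≤ {j | ω ∈ ⋃ i ∈ Finset.Icc 1 (ell n),
      writeEvent M ch A E i j ∩ {ω | ch.x (ω j.1) = i}}.encard := by
  rw [wins, (Set.toFinite _).cast_ncard_eq]
  refine le_trans (Set.encard_le_encard ?_)
    (Set.encard_image_le (fun j : ℕ × ℕ × ℕ => schedule M ch A ω j.2.1) _)
  rintro p ⟨t, ht⟩
  rw [exec_eq_run] at ht
  obtain ⟨s, w, hs, hsw, hR⟩ := exists_writesAt_of_returns ht
  refine ⟨((M.exec ch A ω s).flips, s, w), ?_, hs⟩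
  simp only [Set.mem_ofPred_eq, Set.mem_iUnion]
  refine ⟨ch.x (ω (M.exec ch A ω s).flips), Finset.mem_Icc.2 ⟨ch.one_le _, ch.le_ell _⟩,
    ⟨?_, hω, rfl, hsw, ?_⟩, rfl⟩
  -- Executions extending `E` coincide up to its end, and no process is poised to invoke before
  -- that.
  · by_contra hlt
    rw [not_le] at hlt
    have hpo := hsw.poised
    rw [← exec_eq_run] at hpo
    refine hfirst s hlt (schedule M ch A ω s) ?_
    rw [mem_extends_iff] at hω
    rwa [exec_eq_of_trace_eq M ch A (ω' := ω)]
    have h1 := exec_trace_prefix M ch A ω₀ hlt.le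
    have h2 := exec_trace_prefix M ch A ω hlt.le
    rw [hE] at h1
    rw [hω] at h2
    exact (List.prefix_of_prefix_length_le h1 h2
      (by rw [exec_trace_length, exec_trace_length])).eq_of_length
      (by rw [exec_trace_length, exec_trace_length])
  · rw [exec_eq_run, exec_eq_run]
    exact hR

lemma inv_two_pow_le_prob (ch : IndexChoice n D) {i : ℕ} (h1 : 1 ≤ i) (hi : i ≤ ell n) :
    (2⁻¹ : ℝ≥0∞) ^ i ≤ D.map ch.x i := by
  rcases hi.lt_or_eq with h | rfl
  · rw [ch.prob_of_lt i h1 h]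
  · rw [ch.prob_ell]
    exact pow_le_pow_right_of_le_one' (by simp) (by omega)

lemma mul_inv_two_pow_le {k i j : ℕ} (h : k ≤ 2 ^ (i + j)) :
    (k : ℝ≥0∞) * 2⁻¹ ^ i ≤ 2 ^ j := by
  calc (k : ℝ≥0∞) * 2⁻¹ ^ i ≤ 2 ^ (i + j) * 2⁻¹ ^ i := by
        gcongr
        exact_mod_cast h
    _ = 2 ^ j * (2 ^ i * 2⁻¹ ^ i) := by ring
    _ = 2 ^ j := by
        rw [← mul_pow, ENNReal.mul_inv_cancel (by simp) (by simp), one_pow, mul_one]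

/-- Summation of the bounds for the individual registers. -/
lemma sum_le_of_le_two_of_le_geometric {k N : ℕ} {a : ℕ → ℝ≥0∞} {b : ℝ≥0∞}
    (h2 : ∀ i ∈ Finset.Ico 1 N, a i ≤ 2 * b)
    (hgeom : ∀ i ∈ Finset.Ico 1 N, a i ≤ k * b * 2⁻¹ ^ i) :
    ∑ i ∈ Finset.Ico 1 N, a i ≤ (2 * Nat.log 2 k + 2) * b := by
  -- The bounds cross at `L`: below it each term costs `2 * b`, and from `L + 1` on `k < 2^(L+1)`
  -- makes the terms geometric.
  set L := Nat.log 2 k with hL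
  have hlt : k < 2 ^ (L + 1) := Nat.lt_pow_succ_log_self (by norm_num) k
  have hsmall : ∀ d ≤ L, d + 1 ≤ N → ∑ i ∈ Finset.Ico 1 (d + 1), a i ≤ 2 * d * b := by
    intro d hd hdN
    calc ∑ i ∈ Finset.Ico 1 (d + 1), a i ≤ ∑ i ∈ Finset.Ico 1 (d + 1), 2 * b :=
          Finset.sum_le_sum fun i hi => h2 i (by simp at hi ⊢; omega)
      _ = 2 * d * b := by
          rw [Finset.sum_const, Nat.card_Ico, nsmul_eq_mul, Nat.add_sub_cancel]
          ring
  -- The extra summand `2 * 2⁻¹ ^ d * b` reserves room for the whole geometric tail still to come.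
  have hlarge : ∀ d, L + 1 + d ≤ N →
      ∑ i ∈ Finset.Ico 1 (L + 1 + d), a i + 2 * 2⁻¹ ^ d * b ≤ (2 * L + 2) * b := by
    intro d
    induction d with
    | zero =>
      intro h
      calc _ ≤ 2 * (L : ℝ≥0∞) * b + 2 * 2⁻¹ ^ 0 * b := by
            gcongr
            exact hsmall L le_rfl h
        _ = _ := by ring
    | succ d ih =>
      intro h
      refine le_trans ?_ (ih (by omega))
      rw [← Nat.add_assoc, Finset.sum_Ico_succ_top (by omega), add_assoc]
      gcongr
      have h1 : a (L + 1 + d) ≤ 2⁻¹ ^ d * b := by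
        calc a (L + 1 + d) ≤ k * b * 2⁻¹ ^ (L + 1 + d) := hgeom _ (by simp; omega)
          _ = (k * 2⁻¹ ^ (L + 1)) * 2⁻¹ ^ d * b := by ring
          _ ≤ 1 * 2⁻¹ ^ d * b := by
              gcongr
              simpa using mul_inv_two_pow_le (i := L + 1) (j := 0) hlt.le
          _ = 2⁻¹ ^ d * b := by ring
      have h3 : (2 : ℝ≥0∞) * 2⁻¹ ^ (d + 1) = 2⁻¹ ^ d := by
        rw [pow_succ', ← mul_assoc, ENNReal.mul_inv_cancel (by simp) (by simp), one_mul]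
      rw [h3, two_mul, add_mul]
      gcongr
  by_cases hN : L + 1 ≤ N
  · have := hlarge (N - (L + 1)) (by omega)
    rw [Nat.add_sub_cancel' hN] at this
    exact le_self_add.trans this
  · rcases Nat.eq_zero_or_pos N with rfl | hN0
    · simp
    · have := hsmall (N - 1) (by omega) (by omega)
      rw [Nat.sub_add_cancel hN0] at this
      refine this.trans ?_
      have : ((N - 1 : ℕ) : ℝ≥0∞) ≤ L := by exact_mod_cast (by omega : N - 1 ≤ L)
      gcongr
      exact (mul_le_mul_right this 2).trans le_self_add

variable [Countable Ω] [MeasurableSpace Ω] [DiscreteMeasurableSpace Ω]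

lemma measurableSet_extends (E : Execution n Ω Reg) : MeasurableSet (extends_ M ch A E) :=
  measurableSet_of_dependsOn (dependsOn_extends E)

lemma measurableSet_index_eq (x : Ω → ℕ) (m i : ℕ) :
    MeasurableSet {ω : ℕ → Ω | x (ω m) = i} :=
  ((measurable_of_countable x).comp (measurable_pi_apply m)) (measurableSet_singleton i)

lemma measurableSet_writeEvent (hA : LocationOblivious M ch A) (E : Execution n Ω Reg) (i : ℕ)
    (j : ℕ × ℕ × ℕ) : MeasurableSet (writeEvent M ch A E i j) :=
  measurableSet_of_dependsOn (dependsOn_writeEvent hA E i j)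

lemma measure_writeEvent_inter (hA : LocationOblivious M ch A) (E : Execution n Ω Reg) (i : ℕ)
    (j : ℕ × ℕ × ℕ) (i' : ℕ) :
    coinMeasure D (writeEvent M ch A E i j ∩ {ω | ch.x (ω j.1) = i'})
      = coinMeasure D (writeEvent M ch A E i j) * D.map ch.x i' :=
  coinMeasure_inter_of_dependsOn D (dependsOn_writeEvent hA E i j) (by simp) ch.x i'

lemma tsum_writeEvent_le (hM : M.OneTime ch) (hA : LocationOblivious M ch A)
    {E : Execution n Ω Reg} {k : ℕ} (hk : maxContention M ch E ≤ k) (i : ℕ) :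
    ∑' j, coinMeasure D (writeEvent M ch A E i j) ≤ k * coinMeasure D (extends_ M ch A E) :=
  tsum_measure_le _ (measurableSet_writeEvent hA E i) (measurableSet_extends E)
    (fun _ _ h => h.2.1) fun _ hω => (encard_writeEvent_le hM E i hω).trans (by exact_mod_cast hk)

/-- By independence, the factor turns each summand into the probability that the write also goes to
`R[i+1]`. These events are disjoint: such a write is the first to that register. -/
lemma tsum_writeEvent_mul_le (hM : M.OneTime ch) (hA : LocationOblivious M ch A)
    (E : Execution n Ω Reg) (i : ℕ) :
    (∑' j, coinMeasure D (writeEvent M ch A E i j)) * D.map ch.x (i + 1)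
      ≤ coinMeasure D (extends_ M ch A E) := by
  rw [← ENNReal.tsum_mul_right]
  simp_rw [← measure_writeEvent_inter hA]
  have := tsum_measure_le (k := 1) (coinMeasure D)
    (fun j => (measurableSet_writeEvent hA E i j).inter (measurableSet_index_eq ch.x j.1 (i + 1)))
    (measurableSet_extends E) (fun _ _ h => h.1.2.1)
    fun ω _ => (encard_first_write_le_one hM E i ω).trans_eq (by simp)
  simpa using this

/-- The expected number of elected processes, on the event that the execution extends `E`. -/
lemma setLIntegral_wins_le (hM : M.OneTime ch) (hA : LocationOblivious M ch A) {k : ℕ}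
    (hkn : k ≤ n) {E : Execution n Ω Reg} (hE : E ∈ startExecs M ch A k) :
    ∫⁻ ω in extends_ M ch A E, (wins M ch A ω : ℝ≥0∞) ∂coinMeasure D
      ≤ (2 * Nat.log 2 k + 4) * coinMeasure D (extends_ M ch A E) := by
  obtain ⟨-, ⟨ω₀, t₀, htr, -, hfirst⟩, hcont⟩ := hE
  have ht₀ : E.length = t₀ := by rw [← htr, exec_trace_length]
  subst ht₀
  set b := coinMeasure D (extends_ M ch A E) with hb
  set S : ℕ → ℝ≥0∞ := fun i => ∑' j, coinMeasure D (writeEvent M ch A E i j) with hS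
  have hmeas : ∀ j, MeasurableSet (⋃ i ∈ Finset.Icc 1 (ell n),
      writeEvent M ch A E i j ∩ {ω | ch.x (ω j.1) = i}) := fun j =>
    Finset.measurableSet_biUnion _ fun i _ =>
      (measurableSet_writeEvent hA E i j).inter (measurableSet_index_eq ch.x j.1 i)
  have h1 : ∫⁻ ω in extends_ M ch A E, (wins M ch A ω : ℝ≥0∞) ∂coinMeasure D
      ≤ ∑ i ∈ Finset.Icc 1 (ell n), S i * D.map ch.x i := by
    calc ∫⁻ ω in extends_ M ch A E, (wins M ch A ω : ℝ≥0∞) ∂coinMeasure D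
        ≤ ∫⁻ ω in extends_ M ch A E, ({j | ω ∈ ⋃ i ∈ Finset.Icc 1 (ell n),
            writeEvent M ch A E i j ∩ {ω | ch.x (ω j.1) = i}}.encard : ℝ≥0∞) ∂coinMeasure D := by
          refine setLIntegral_mono' (measurableSet_extends E) fun ω hω => ?_
          exact le_trans (by simp) (ENat.toENNReal_mono (wins_le_encard htr hfirst hω))
      _ ≤ ∫⁻ ω, ({j | ω ∈ ⋃ i ∈ Finset.Icc 1 (ell n),
            writeEvent M ch A E i j ∩ {ω | ch.x (ω j.1) = i}}.encard : ℝ≥0∞) ∂coinMeasure D :=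
          setLIntegral_le_lintegral _ _
      _ = ∑' j, coinMeasure D (⋃ i ∈ Finset.Icc 1 (ell n),
            writeEvent M ch A E i j ∩ {ω | ch.x (ω j.1) = i}) :=
          lintegral_encard_eq_tsum _ hmeas
      _ ≤ ∑' j, ∑ i ∈ Finset.Icc 1 (ell n), coinMeasure D (writeEvent M ch A E i j)
            * D.map ch.x i := by
          refine ENNReal.tsum_le_tsum fun j => ?_
          refine (measure_biUnion_finset_le _ _).trans_eq ?_
          exact Finset.sum_congr rfl fun i _ => measure_writeEvent_inter hA E i j i
      _ = ∑ i ∈ Finset.Icc 1 (ell n), S i * D.map ch.x i := by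
          rw [Summable.tsum_finsetSum fun _ _ => ENNReal.summable]
          simp_rw [hS, ENNReal.tsum_mul_right]
  have hell : 1 ≤ ell n := by
    have := ch.one_le (ω₀ 0)
    exact this.trans (ch.le_ell _)
  have hSk : ∀ i, S i ≤ k * b := fun i => tsum_writeEvent_le hM hA hcont i
  -- `R[ell n + 1]` is never written, so only `S ≤ k * b` helps here; it suffices because `k ≤ n ≤ 2
  -- ^ ell n`.
  have hlast : S (ell n) * D.map ch.x (ell n) ≤ 2 * b := by
    rw [ch.prob_ell]
    calc S (ell n) * 2⁻¹ ^ (ell n - 1) ≤ k * b * 2⁻¹ ^ (ell n - 1) := by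
          gcongr
          exact hSk _
      _ = k * 2⁻¹ ^ (ell n - 1) * b := by ring
      _ ≤ 2 ^ 1 * b := by
          gcongr
          refine mul_inv_two_pow_le ?_
          rw [Nat.sub_add_cancel hell]
          exact hkn.trans (Nat.le_pow_clog (by norm_num) n)
      _ = 2 * b := by rw [pow_one]
  have hrest : ∑ i ∈ Finset.Ico 1 (ell n), S i * D.map ch.x i ≤ (2 * Nat.log 2 k + 2) * b := by
    refine sum_le_of_le_two_of_le_geometric (fun i hi => ?_) fun i hi => ?_
    all_goals
      rw [Finset.mem_Ico] at hi
      rw [ch.prob_of_lt i hi.1 hi.2]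
    -- The factor 2 is the price of passing from index `i` to `i + 1`, whose probability controls
    -- the first write.
    · calc S i * 2⁻¹ ^ i = 2 * (S i * 2⁻¹ ^ (i + 1)) := by
            have : (2 : ℝ≥0∞) * 2⁻¹ = 1 := ENNReal.mul_inv_cancel (by simp) (by simp)
            calc S i * 2⁻¹ ^ i = (2 * 2⁻¹) * (S i * 2⁻¹ ^ i) := by rw [this, one_mul]
              _ = 2 * (S i * 2⁻¹ ^ (i + 1)) := by ring
        _ ≤ 2 * (S i * D.map ch.x (i + 1)) := by
            gcongr
            exact inv_two_pow_le_prob ch (by omega) (by omega)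
        _ ≤ 2 * b := by
            gcongr
            exact tsum_writeEvent_mul_le hM hA E i
    · gcongr
      exact hSk i
  refine h1.trans ?_
  rw [← Finset.Ico_add_one_right_eq_Icc, Finset.sum_Ico_succ_top hell]
  calc _ ≤ (2 * (Nat.log 2 k : ℝ≥0∞) + 2) * b + 2 * b := add_le_add hrest hlast
    _ = _ := by ring

lemma effectiveness_le (hM : M.OneTime ch) (hA : LocationOblivious M ch A) {k : ℕ}
    (hkn : k ≤ n) :
    effectiveness M ch A k ≤ ENNReal.ofReal (2 * Real.logb 2 k + 4) := by
  have hlog : (2 * Nat.log 2 k + 4 : ℝ≥0∞) ≤ ENNReal.ofReal (2 * Real.logb 2 k + 4) := by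
    have h1 : (Nat.log 2 k : ℝ) ≤ Real.logb 2 k := by
      exact_mod_cast Real.natLog_le_logb k 2
    have h2 : (2 * Nat.log 2 k + 4 : ℝ≥0∞) = ENNReal.ofReal ((2 * Nat.log 2 k + 4 : ℕ) : ℝ) := by
      rw [ENNReal.ofReal_natCast]
      push_cast
      rfl
    rw [h2]
    apply ENNReal.ofReal_le_ofReal
    push_cast
    linarith
  refine (iSup₂_le fun E hE => ?_).trans hlog
  rw [ProbabilityTheory.cond, lintegral_smul_measure, smul_eq_mul]
  calc _ ≤ (coinMeasure D (extends_ M ch A E))⁻¹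
        * ((2 * Nat.log 2 k + 4) * coinMeasure D (extends_ M ch A E)) := by
        gcongr
        exact setLIntegral_wins_le hM hA hkn hE
    _ = (2 * Nat.log 2 k + 4) * ((coinMeasure D (extends_ M ch A E))⁻¹
        * coinMeasure D (extends_ M ch A E)) := by ring
    _ = 2 * Nat.log 2 k + 4 := by
        -- The conditioning event has positive probability by the definition of `startExecs`.
        rw [ENNReal.inv_mul_cancel hE.1 (measure_ne_top _ _), mul_one]

end Effectiveness

/-! ### Max-step complexity, from the pointwise bound. -/

section MaxSteps

variable {n : ℕ} {Ω Reg State : Type*} [DecidableEq Reg] {D : PMF Ω}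
variable {M : Algorithm n Ω Reg State} {ch : IndexChoice n D} {A : Adversary n Ω Reg}

lemma maxSteps_le_two (hM : M.OneTime ch) (ω : ℕ → Ω) : maxSteps M ch A ω ≤ 2 :=
  iSup₂_le fun p t => by
    exact_mod_cast electSteps_le_two hM (reachable_exec M ch A ω t) p

variable [MeasurableSpace Ω]

lemma isProbabilityMeasure_cond_extends {k : ℕ} {E : Execution n Ω Reg}
    (hE : E ∈ startExecs M ch A k) :
    IsProbabilityMeasure (cond (coinMeasure D) (extends_ M ch A E)) :=
  cond_isProbabilityMeasure hE.1

lemma maxStepsBoundedWithProb_two (hM : M.OneTime ch) (k : ℕ) :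
    MaxStepsBoundedWithProb M ch A (fun _ => 2) (fun _ => 1) k := by
  intro E hE
  have := isProbabilityMeasure_cond_extends hE
  rw [Set.eq_univ_of_forall (s := {ω | maxSteps M ch A ω ≤ 2}) fun ω => maxSteps_le_two hM ω,
    measure_univ]

lemma expectedMaxSteps_le_two (hM : M.OneTime ch) (k : ℕ) : expectedMaxSteps M ch A k ≤ 2 := by
  refine iSup₂_le fun E hE => ?_
  have := isProbabilityMeasure_cond_extends hE
  calc _ ≤ ∫⁻ _, 2 ∂(cond (coinMeasure D) (extends_ M ch A E)) :=
        lintegral_mono fun ω => maxSteps_le_two hM ω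
    _ = 2 := by simp

end MaxSteps

end GroupElection

theorem lemma3p3 (n : ℕ) (hn : 2 ≤ n) {Ω Reg State : Type*} [Countable Ω] [MeasurableSpace Ω]
    [DiscreteMeasurableSpace Ω] [DecidableEq Reg] (D : PMF Ω) (ch : IndexChoice n D)
    (M : Algorithm n Ω Reg State) (hM : M.OneTime ch) :
    -- it is a group election object, in every execution
    (∀ C, M.Reachable ch C → GroupElectionProperty C.trace) ∧
    -- a call returns after at most three further steps of the calling process
    (∀ (σ : ℕ → Fin n) (ω : ℕ → Ω) (t t' : ℕ) (p : Fin n),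
      Participates (M.run ch σ ω t).trace p →
      3 ≤ ((Finset.Ico t t').filter fun s => σ s = p).card →
      ∃ b, Returns (M.run ch σ ω t').trace p b) ∧
    -- constant max-step complexity, in every execution
    (∀ C, M.Reachable ch C → ∀ p, electSteps C.trace p ≤ 2) ∧
    -- max-step complexity and effectiveness against location-oblivious adversaries
    (∀ A : Adversary n Ω Reg, LocationOblivious M ch A → ∀ k : ℕ, 1 ≤ k → k ≤ n →
      MaxStepsBoundedWithProb M ch A (fun _ => 2) (fun _ => 1) k ∧
      expectedMaxSteps M ch A k ≤ 2 ∧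
      effectiveness M ch A k ≤ ENNReal.ofReal (2 * Real.logb 2 k + 4)) :=
  ⟨fun _ hC => hC.groupElectionProperty hM, exists_returns_of_three_steps M ch,
    fun _ hC => electSteps_le_two hM hC, fun _ hA k _ hkn =>
    ⟨maxStepsBoundedWithProb_two hM k, expectedMaxSteps_le_two hM k,
      effectiveness_le hM hA hkn⟩⟩
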